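/- Let $N\in\mathbb N$ and let $\alpha_1,\dots,\alpha_N\in(0,\infty)$ satisfy $\alpha_j-\alpha_k\notin\mathbb Z$ for all $j\neq k$. Let $f_1,\dots,f_N\in C^\infty((0,\infty);\mathbb C)$, and assume that there are constants $c>0$ and $\delta>0$ such that for every $j=1,\dots,N$ $$|f_j(t)|\le c\,e^{-\delta t}\quad\text{for } t\in[1,\infty),\qquad |f_j(t)|\le c\,e^{-\delta/t}\quad\text{for } t\in(0,1].$$ Suppose that there exists $l\in\mathbb N$ such that $$\sum_{j=1}^N\Gamma(m+1+\alpha_j)\int_0^\infty f_j(t)\,t^{-m}\,dt=0\qquad\text{for all } m=l,l+1,l+2,\dots.$$ Then $f_j(t)=0$ for all $t\in(0,\infty)$ and all $j=1,\dots,N$. -/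

import Mathlib

open scoped ContDiff

open Filter Topology MeasureTheory Set

/-! Let `L j` be the Laplace transform of `t ^ (α j + 1) * f j t`. By Fubini and the Gamma integral
(`moment_laplace_rpowWeight`), the hypothesis says that `Φ u = ∑ j, u ^ α j * L j u` has vanishing
moments on `(0, ∞)` from order `l` on. Decay of `f j` at 0 forces `L j u` to be `O(exp (-2κ√u))`
(`norm_laplace_rpowWeight_le`). This is just enough for determinacy: under `u = v ^ 2` the moments
become those of an even, exponentially decaying function on the line, so `Φ = 0`
(`sum_rpow_mul_eq_zero_of_moments`). Decay of `f j` at infinity makes `L j` analytic at 0.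
Non-integer differences of the `α j` keep the leading powers of `u` from cancelling, so each `L j`
vanishes near 0 (`eventually_eq_zero_of_sum_rpow_mul_eq_zero`). Analytic continuation and Fourier
inversion then give `f j = 0`. -/

/-! ### Laplace transforms on a strip: analyticity, injectivity, moments. -/

/-- The bilateral Laplace transform of `g`. -/
noncomputable def laplace (g : ℝ → ℂ) (z : ℂ) : ℂ :=
  ∫ t : ℝ, Complex.exp (-(z * t)) * g t

/-- The vertical strip `|Re z| < ε`. -/
def verticalStrip (ε : ℝ) : Set ℂ := {z | |z.re| < ε}

theorem isOpen_verticalStrip (ε : ℝ) : IsOpen (verticalStrip ε) :=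
  isOpen_lt (Complex.continuous_re.abs) continuous_const

theorem isPreconnected_verticalStrip (ε : ℝ) : IsPreconnected (verticalStrip ε) := by
  have h : verticalStrip ε = Complex.reLm ⁻¹' (Ioo (-ε) ε) := by
    ext z
    simp [verticalStrip, abs_lt]
  rw [h]
  exact ((convex_Ioo (-ε) ε).linear_preimage Complex.reLm).isPreconnected

theorem norm_exp_neg_mul_le (z : ℂ) (t : ℝ) :
    ‖Complex.exp (-(z * t))‖ ≤ Real.exp (|z.re| * |t|) := by
  rw [Complex.norm_exp]
  apply Real.exp_le_exp.2
  have : (-(z * (t : ℂ))).re = -(z.re * t) := by simp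
  rw [this, ← abs_mul]
  exact neg_le_abs _

theorem aestronglyMeasurable_exp_neg_mul {g : ℝ → ℂ} (hg : AEStronglyMeasurable g volume) (z : ℂ) :
    AEStronglyMeasurable (fun t : ℝ => Complex.exp (-(z * t)) * g t) volume :=
  (by fun_prop : Continuous fun t : ℝ => Complex.exp (-(z * t))).aestronglyMeasurable.mul hg

theorem differentiableOn_laplace {g : ℝ → ℂ} {ε : ℝ} (hg : AEStronglyMeasurable g volume)
    (hint : Integrable fun t : ℝ => Real.exp (ε * |t|) * ‖g t‖) :
    DifferentiableOn ℂ (laplace g) (verticalStrip ε) := by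
  intro z hz
  have hz' : |z.re| < ε := hz
  set r := (ε - |z.re|) / 2 with hr
  have hr0 : 0 < r := by simp only [hr]; linarith
  have hre : ∀ w ∈ Metric.ball z r, |w.re| ≤ ε - r := by
    intro w hw
    have h1 : |w.re - z.re| ≤ ‖w - z‖ := by simpa using Complex.abs_re_le_norm (w - z)
    have h2 : ‖w - z‖ < r := by simpa [dist_eq_norm] using hw
    have h3 := abs_sub_abs_le_abs_sub w.re z.re
    simp only [hr] at *
    linarith
  have key := hasDerivAt_integral_of_dominated_loc_of_deriv_le (μ := volume) (𝕜 := ℂ)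
    (F := fun w (t : ℝ) => Complex.exp (-(w * t)) * g t)
    (F' := fun w (t : ℝ) => Complex.exp (-(w * t)) * (-t) * g t) (x₀ := z)
    (s := Metric.ball z r)
    (bound := fun t => r⁻¹ * (Real.exp (ε * |t|) * ‖g t‖))
    (Metric.ball_mem_nhds z hr0)
    (Eventually.of_forall fun w => aestronglyMeasurable_exp_neg_mul hg w) ?_ ?_ ?_ ?_ ?_
  · exact key.2.differentiableAt.differentiableWithinAt
  · refine hint.mono' (aestronglyMeasurable_exp_neg_mul hg z) (Eventually.of_forall fun t => ?_)
    rw [norm_mul]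
    gcongr
    exact (norm_exp_neg_mul_le z t).trans (Real.exp_le_exp.2 (by gcongr))
  · exact (by fun_prop : Continuous fun t : ℝ => Complex.exp (-(z * t)) * (-t)).aestronglyMeasurable.mul hg
  · refine Eventually.of_forall fun t w hw => ?_
    rw [norm_mul, norm_mul, ← mul_assoc]
    refine mul_le_mul_of_nonneg_right ?_ (norm_nonneg _)
    have h1 := norm_exp_neg_mul_le w t
    -- The factor `t` from differentiating the kernel is absorbed by the margin `r` left between the
    -- ball and the edge of the strip.
    have h2 : |t| ≤ r⁻¹ * Real.exp (r * |t|) := by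
      rw [inv_mul_eq_div, le_div_iff₀ hr0]
      linarith [Real.add_one_le_exp (r * |t|)]
    calc ‖Complex.exp (-(w * t))‖ * ‖(-(t : ℂ))‖
        ≤ Real.exp ((ε - r) * |t|) * (r⁻¹ * Real.exp (r * |t|)) := by
          rw [norm_neg, Complex.norm_real, Real.norm_eq_abs]
          gcongr
          exact h1.trans (Real.exp_le_exp.2 (by gcongr; exact hre w hw))
      _ = r⁻¹ * Real.exp (ε * |t|) := by
          rw [mul_left_comm, ← Real.exp_add]; ring_nf
  · exact hint.const_mul _
  · refine Eventually.of_forall fun t w _ => ?_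
    have : HasDerivAt (fun w : ℂ => -(w * t)) (-t) w := by
      simpa using ((hasDerivAt_id' w).mul_const (t : ℂ)).fun_neg
    exact this.cexp.mul_const _

theorem laplace_eq_zero_of_frequently {g : ℝ → ℂ} {ε : ℝ} (hε : 0 < ε)
    (hg : AEStronglyMeasurable g volume)
    (hint : Integrable fun t : ℝ => Real.exp (ε * |t|) * ‖g t‖)
    (h0 : ∃ᶠ z in 𝓝[≠] 0, laplace g z = 0) : EqOn (laplace g) 0 (verticalStrip ε) :=
  ((differentiableOn_laplace hg hint).analyticOnNhd
    (isOpen_verticalStrip ε)).eqOn_zero_of_preconnected_of_frequently_eq_zero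
    (isPreconnected_verticalStrip ε) (by simpa [verticalStrip] using hε) h0

/-- On the imaginary axis the Laplace transform is a rescaled Fourier transform, so Fourier
inversion applies at points of continuity. -/
theorem eq_zero_of_laplace_eq_zero {g : ℝ → ℂ} (hg : Integrable g)
    (h0 : ∀ y : ℝ, laplace g (y * Complex.I) = 0) {x : ℝ} (hx : ContinuousAt g x) : g x = 0 := by
  have hF : FourierTransform.fourier g = 0 := by
    ext w
    rw [Real.fourier_real_eq_integral_exp_smul]
    simp only [Pi.zero_apply]
    rw [← h0 (2 * Real.pi * w), laplace]
    congr 1 with t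
    rw [smul_eq_mul]
    congr 2
    push_cast
    ring
  have := hg.fourierInv_fourier_eq (v := x) (by rw [hF]; exact integrable_zero _ _ _) hx
  rw [hF] at this
  rw [← this, Real.fourierInv_eq]
  simp

theorem integrable_of_exp_mul {g : ℝ → ℂ} {ε : ℝ} (hε : 0 < ε) (hg : AEStronglyMeasurable g volume)
    (hint : Integrable fun t : ℝ => Real.exp (ε * |t|) * ‖g t‖) : Integrable g := by
  refine hint.mono' hg (Eventually.of_forall fun t => ?_)
  exact le_mul_of_one_le_left (norm_nonneg _) (Real.one_le_exp (by positivity))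

theorem eq_zero_of_frequently_laplace_eq_zero {g : ℝ → ℂ} {ε : ℝ} (hε : 0 < ε)
    (hg : AEStronglyMeasurable g volume)
    (hint : Integrable fun t : ℝ => Real.exp (ε * |t|) * ‖g t‖)
    (h0 : ∃ᶠ z in 𝓝[≠] 0, laplace g z = 0) {x : ℝ} (hx : ContinuousAt g x) : g x = 0 := by
  refine eq_zero_of_laplace_eq_zero (integrable_of_exp_mul hε hg hint) (fun y => ?_) hx
  exact laplace_eq_zero_of_frequently hε hg hint h0 (by simpa [verticalStrip] using hε)

/-- Expand the exponential and integrate termwise; the partial sums are dominated by `exp (‖z‖ *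
|t|) * ‖g t‖`. -/
theorem laplace_eq_zero_of_moments {g : ℝ → ℂ} {ε : ℝ} (hg : AEStronglyMeasurable g volume)
    (hint : Integrable fun t : ℝ => Real.exp (ε * |t|) * ‖g t‖)
    (hm : ∀ n : ℕ, ∫ t : ℝ, (t : ℂ) ^ n * g t = 0) {z : ℂ} (hz : ‖z‖ < ε) : laplace g z = 0 := by
  have hsum : ∀ t : ℝ, HasSum (fun n : ℕ => (‖z‖ * |t|) ^ n / n.factorial * ‖g t‖)
      (Real.exp (‖z‖ * |t|) * ‖g t‖) := fun t => by
    rw [Real.exp_eq_exp_ℝ]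
    exact (NormedSpace.expSeries_div_hasSum_exp (‖z‖ * |t|)).mul_right _
  have key := hasSum_integral_of_dominated_convergence (μ := volume)
    (F := fun (n : ℕ) (t : ℝ) => (-(z * t)) ^ n / n.factorial * g t)
    (f := fun t : ℝ => Complex.exp (-(z * t)) * g t)
    (bound := fun n t => (‖z‖ * |t|) ^ n / n.factorial * ‖g t‖) ?_ ?_ ?_ ?_ ?_
  · have h0 : ∀ n : ℕ, ∫ t : ℝ, (-(z * t)) ^ n / n.factorial * g t = 0 := fun n => by
      have : ∀ t : ℝ, (-(z * t)) ^ n / n.factorial * g t =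
          ((-z) ^ n / n.factorial) * ((t : ℂ) ^ n * g t) := fun t => by ring
      simp_rw [this]
      rw [integral_const_mul, hm, mul_zero]
    simp_rw [h0] at key
    exact key.unique hasSum_zero
  · intro n
    exact (by fun_prop : Continuous fun t : ℝ =>
      (-(z * t)) ^ n / (n.factorial : ℂ)).aestronglyMeasurable.mul hg
  · intro n
    refine Eventually.of_forall fun t => le_of_eq ?_
    simp
  · exact Eventually.of_forall fun t => (hsum t).summable
  · simp_rw [fun t => (hsum t).tsum_eq]
    refine hint.mono' ?_ (Eventually.of_forall fun t => ?_)
    · exact (by fun_prop : Continuous fun t : ℝ =>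
        Real.exp (‖z‖ * |t|)).aestronglyMeasurable.mul hg.norm
    · rw [Real.norm_of_nonneg (by positivity)]
      gcongr
  · refine Eventually.of_forall fun t => ?_
    rw [Complex.exp_eq_exp_ℂ]
    exact (NormedSpace.expSeries_div_hasSum_exp (-(z * (t : ℂ)))).mul_right _

theorem eq_zero_of_moments_eq_zero {g : ℝ → ℂ} {ε : ℝ} (hε : 0 < ε)
    (hg : AEStronglyMeasurable g volume)
    (hint : Integrable fun t : ℝ => Real.exp (ε * |t|) * ‖g t‖)
    (hm : ∀ n : ℕ, ∫ t : ℝ, (t : ℂ) ^ n * g t = 0) {x : ℝ} (hx : ContinuousAt g x) : g x = 0 := by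
  refine eq_zero_of_frequently_laplace_eq_zero hε hg hint (Eventually.frequently ?_) hx
  filter_upwards [nhdsWithin_le_nhds (Metric.ball_mem_nhds (0 : ℂ) hε)] with z hz
  exact laplace_eq_zero_of_moments hg hint hm (by simpa using hz)

/-! ### Independence of powers with non-integer exponent differences. -/

/-- A relation among powers of `u` whose exponents differ by non-integers, with analytic
coefficients, is trivial. -/
theorem eventually_eq_zero_of_sum_rpow_mul_eq_zero {ι : Type*} [Fintype ι] {α : ι → ℝ}
    (hdiff : ∀ j k, j ≠ k → ∀ n : ℤ, α j - α k ≠ (n : ℝ)) {L : ι → ℂ → ℂ}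
    (hL : ∀ j, AnalyticAt ℂ (L j) 0)
    (h0 : ∀ u : ℝ, 0 < u → ∑ j, ((u ^ α j : ℝ) : ℂ) * L j u = 0) (j : ι) :
    ∀ᶠ z in 𝓝 0, L j z = 0 := by
  classical
  by_contra hj
  let S : Finset ι := Finset.univ.filter fun j => ¬ ∀ᶠ z in 𝓝 0, L j z = 0
  have hS : S.Nonempty := ⟨j, by simpa [S] using hj⟩
  have hex : ∀ k, ∃ (n : ℕ) (h : ℂ → ℂ), k ∈ S →
      ContinuousAt h 0 ∧ h 0 ≠ 0 ∧ ∀ᶠ z in 𝓝 0, L k z = z ^ n * h z := by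
    intro k
    by_cases hk : k ∈ S
    · obtain ⟨n, h, h1, h2, h3⟩ :=
        (hL k).exists_eventuallyEq_pow_smul_nonzero_iff.2 (by simpa [S] using hk)
      exact ⟨n, h, fun _ => ⟨h1.continuousAt, h2, by simpa using h3⟩⟩
    · exact ⟨0, 0, fun h => absurd h hk⟩
  choose n h hh using hex
  -- `α k + n k` is the leading exponent of the `k`-th term. After division by the smallest such
  -- power, only the term `i` survives as `u → 0+`.
  obtain ⟨i, hi, hmin⟩ := S.exists_min_image (fun k => α k + n k) hS
  have hcast : Tendsto (fun u : ℝ => (u : ℂ)) (𝓝[>] 0) (𝓝 0) := by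
    have : Tendsto (fun u : ℝ => (u : ℂ)) (𝓝 0) (𝓝 ((0 : ℝ) : ℂ)) :=
      Complex.continuous_ofReal.tendsto 0
    exact (by simpa using this : Tendsto _ (𝓝 (0 : ℝ)) (𝓝 (0 : ℂ))).mono_left nhdsWithin_le_nhds
  have hlim : Tendsto (fun u : ℝ => ∑ k ∈ S,
      ((u ^ (α k + n k - (α i + n i)) : ℝ) : ℂ) * h k u) (𝓝[>] 0)
      (𝓝 (∑ k ∈ S, (if k = i then 1 else 0) * h k 0)) := by
    refine tendsto_finsetSum _ fun k hk => Tendsto.mul ?_ ((hh k hk).1.tendsto.comp hcast)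
    split_ifs with hki
    · subst hki
      simp
    -- The minimum is strict: a tie would make `α k - α i` an integer.
    · have hpos : 0 < α k + n k - (α i + n i) := by
        refine lt_of_le_of_ne (sub_nonneg.2 (hmin k hk)) fun heq => ?_
        apply hdiff k i hki (n i - n k)
        push_cast
        linarith
      have : Tendsto (fun u : ℝ => u ^ (α k + n k - (α i + n i))) (𝓝 0) (𝓝 0) := by
        simpa [Real.zero_rpow hpos.ne'] using
          (Real.continuous_rpow_const hpos.le).tendsto 0
      simpa [Function.comp_def] using (Complex.continuous_ofReal.tendsto 0).comp (this.mono_left nhdsWithin_le_nhds)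
  have hzero : ∀ᶠ u : ℝ in 𝓝[>] 0, ∑ k ∈ S,
      ((u ^ (α k + n k - (α i + n i)) : ℝ) : ℂ) * h k u = 0 := by
    have hall : ∀ᶠ u : ℝ in 𝓝[>] 0, ∀ k, L k u = if k ∈ S then (u : ℂ) ^ n k * h k u else 0 := by
      rw [eventually_all]
      intro k
      apply hcast.eventually (p := fun z => L k z = if k ∈ S then z ^ n k * h k z else 0)
      split_ifs with hk
      · exact (hh k hk).2.2
      · simpa [S] using hk
    filter_upwards [hall, self_mem_nhdsWithin] with u hu hu0
    have hu0' : 0 < u := hu0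
    have h1 := h0 u hu0
    simp_rw [hu] at h1
    have h2 : ∑ k ∈ S, ((u ^ α k : ℝ) : ℂ) * ((u : ℂ) ^ n k * h k u) = 0 := by
      rw [← h1]
      simp
    have h3 : ((u ^ (α i + n i) : ℝ) : ℂ) ≠ 0 :=
      Complex.ofReal_ne_zero.2 (Real.rpow_pos_of_pos hu0' _).ne'
    refine (mul_eq_zero_iff_left h3).1 ?_
    rw [← h2, Finset.mul_sum]
    refine Finset.sum_congr rfl fun k _ => ?_
    rw [← mul_assoc, ← mul_assoc, ← Complex.ofReal_mul, ← Real.rpow_add hu0', ← Complex.ofReal_pow,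
      ← Complex.ofReal_mul, ← Real.rpow_natCast, ← Real.rpow_add hu0']
    rw [show α i + n i + (α k + n k - (α i + n i)) = α k + n k by ring]
  have := tendsto_nhds_unique hlim ((tendsto_congr' hzero).2 tendsto_const_nhds)
  simp [hi] at this
  exact (hh i hi).2.1 this

/-! ### Decay bounds and integrability. -/

theorem add_inv_le_of_one_le {t : ℝ} (ht : 1 ≤ t) : t + t⁻¹ ≤ 2 * t := by
  linarith [inv_le_one_of_one_le₀ ht]

theorem norm_le_of_two_sided_decay {F : Type*} [Norm F] {f : ℝ → F} {c δ : ℝ} (hc : 0 < c)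
    (hδ : 0 < δ) (h1 : ∀ t : ℝ, 1 ≤ t → ‖f t‖ ≤ c * Real.exp (-δ * t))
    (h2 : ∀ t : ℝ, 0 < t → t ≤ 1 → ‖f t‖ ≤ c * Real.exp (-δ / t)) {t : ℝ} (ht : 0 < t) :
    ‖f t‖ ≤ c * Real.exp (-(δ / 2 * (t + t⁻¹))) := by
  rcases le_total 1 t with h | h
  · refine (h1 t h).trans ?_
    gcongr
    nlinarith [add_inv_le_of_one_le h]
  · refine (h2 t ht h).trans ?_
    gcongr
    have := add_inv_le_of_one_le (one_le_inv_iff₀.2 ⟨ht, h⟩)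
    rw [inv_inv] at this
    rw [div_eq_mul_inv]
    nlinarith

theorem integrableOn_rpow_mul_exp_neg_mul {s b : ℝ} (hs : -1 < s) (hb : 0 < b) :
    IntegrableOn (fun x : ℝ => x ^ s * Real.exp (-(b * x))) (Ioi 0) := by
  simpa using integrableOn_rpow_mul_exp_neg_mul_rpow hs one_pos hb

theorem integrable_abs_rpow_mul_exp_neg_mul_abs {s b : ℝ} (hs : -1 < s) (hb : 0 < b) :
    Integrable fun x : ℝ => |x| ^ s * Real.exp (-(b * |x|)) := by
  have h := integrableOn_rpow_mul_exp_neg_mul hs hb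
  have hpos : IntegrableOn (fun x : ℝ => |x| ^ s * Real.exp (-(b * |x|))) (Ioi 0) :=
    h.congr_fun (fun x hx => by simp only [abs_of_pos (mem_Ioi.1 hx)]) measurableSet_Ioi
  rw [← integrableOn_univ, ← Iio_union_Ici (a := (0 : ℝ)), integrableOn_union,
    integrableOn_Ici_iff_integrableOn_Ioi]
  refine ⟨?_, hpos⟩
  rw [← (Measure.measurePreserving_neg (volume : Measure ℝ)).integrableOn_comp_preimage
    (Homeomorph.neg ℝ).measurableEmbedding]
  simpa [Function.comp_def] using hpos

/-! ### Laplace transforms of the weighted functions. -/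

/-- The function `t ↦ t ^ (a + 1) * f t` on `(0, ∞)`, extended by zero. -/
noncomputable def rpowWeight (a : ℝ) (f : ℝ → ℂ) : ℝ → ℂ :=
  indicator (Ioi 0) fun t => ((t ^ (a + 1) : ℝ) : ℂ) * f t

theorem laplace_rpowWeight (a : ℝ) (f : ℝ → ℂ) (z : ℂ) :
    laplace (rpowWeight a f) z =
      ∫ t in Ioi (0 : ℝ), Complex.exp (-(z * t)) * (((t ^ (a + 1) : ℝ) : ℂ) * f t) := by
  rw [← integral_indicator measurableSet_Ioi, laplace]
  congr 1 with t
  by_cases ht : t ∈ Ioi (0 : ℝ) <;> simp [rpowWeight, ht]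

theorem aestronglyMeasurable_rpow_mul {a : ℝ} {f : ℝ → ℂ} (hf : ContinuousOn f (Ioi 0)) :
    AEStronglyMeasurable (fun t => ((t ^ (a + 1) : ℝ) : ℂ) * f t) (volume.restrict (Ioi 0)) :=
  (by fun_prop : Measurable fun t : ℝ => ((t ^ (a + 1) : ℝ) : ℂ)).aestronglyMeasurable.mul
    (hf.aestronglyMeasurable measurableSet_Ioi)

theorem aestronglyMeasurable_rpowWeight {a : ℝ} {f : ℝ → ℂ} (hf : ContinuousOn f (Ioi 0)) :
    AEStronglyMeasurable (rpowWeight a f) volume :=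
  (aestronglyMeasurable_indicator_iff measurableSet_Ioi).2 (aestronglyMeasurable_rpow_mul hf)

theorem continuousAt_rpowWeight {a : ℝ} {f : ℝ → ℂ} (hf : ContinuousOn f (Ioi 0)) {t : ℝ}
    (ht : 0 < t) : ContinuousAt (rpowWeight a f) t := by
  have hc : ContinuousAt (fun t : ℝ => ((t ^ (a + 1) : ℝ) : ℂ) * f t) t :=
    (Complex.continuous_ofReal.continuousAt.comp
      (Real.continuousAt_rpow_const t (a + 1) (Or.inl ht.ne'))).mul
      (hf.continuousAt (Ioi_mem_nhds ht))
  refine hc.congr ?_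
  filter_upwards [Ioi_mem_nhds ht] with s hs
  simp only [rpowWeight, indicator_of_mem hs]

section TwoSidedDecay

variable {a c κ : ℝ} {f : ℝ → ℂ}

theorem integrable_exp_mul_norm_rpowWeight (ha : 0 < a) (hκ : 0 < κ)
    (hf : ContinuousOn f (Ioi 0))
    (hb : ∀ t, 0 < t → ‖f t‖ ≤ c * Real.exp (-(κ ^ 2 * (t + t⁻¹)))) :
    Integrable fun t : ℝ => Real.exp (κ ^ 2 / 2 * |t|) * ‖rpowWeight a f t‖ := by
  have hc : 0 ≤ c := nonneg_of_mul_nonneg_left ((norm_nonneg _).trans (hb 1 one_pos))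
    (Real.exp_pos _)
  have h1 : Integrable (indicator (Ioi 0) fun t : ℝ =>
      c * (t ^ (a + 1) * Real.exp (-(κ ^ 2 / 2 * t)))) :=
    (integrable_indicator_iff measurableSet_Ioi).2
      ((integrableOn_rpow_mul_exp_neg_mul (by linarith) (by positivity)).const_mul c)
  refine h1.mono' ?_ (Eventually.of_forall fun t => ?_)
  · exact (by fun_prop : Continuous fun t : ℝ =>
      Real.exp (κ ^ 2 / 2 * |t|)).aestronglyMeasurable.mul (aestronglyMeasurable_rpowWeight hf).norm
  by_cases ht : t ∈ Ioi (0 : ℝ)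
  · have ht' : 0 < t := ht
    simp only [rpowWeight, indicator_of_mem ht]
    rw [Real.norm_of_nonneg (by positivity), norm_mul, Complex.norm_real, Real.norm_of_nonneg
      (by positivity), abs_of_pos ht']
    calc Real.exp (κ ^ 2 / 2 * t) * (t ^ (a + 1) * ‖f t‖)
        ≤ Real.exp (κ ^ 2 / 2 * t) * (t ^ (a + 1) * (c * Real.exp (-(κ ^ 2 * t)))) := by
          gcongr
          refine (hb t ht').trans ?_
          gcongr
          linarith [inv_pos.2 ht']
      _ = c * (t ^ (a + 1) * (Real.exp (κ ^ 2 / 2 * t) * Real.exp (-(κ ^ 2 * t)))) := by ring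
      _ = _ := by rw [← Real.exp_add]; ring_nf
  · simp [rpowWeight, ht]

theorem norm_laplace_rpowWeight_le (ha : 0 < a) (hκ : 0 < κ)
    (hb : ∀ t, 0 < t → ‖f t‖ ≤ c * Real.exp (-(2 * κ ^ 2 * (t + t⁻¹)))) :
    ∃ C, ∀ v : ℝ, ‖laplace (rpowWeight a f) ((v ^ 2 : ℝ) : ℂ)‖ ≤ C * Real.exp (-(2 * κ * |v|)) := by
  have hc : 0 ≤ c := nonneg_of_mul_nonneg_left ((norm_nonneg _).trans (hb 1 one_pos))
    (Real.exp_pos _)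
  refine ⟨∫ t in Ioi (0 : ℝ), c * (t ^ (a + 1) * Real.exp (-(κ ^ 2 * t))), fun v => ?_⟩
  rw [laplace_rpowWeight, ← integral_mul_const]
  refine norm_integral_le_of_norm_le (((integrableOn_rpow_mul_exp_neg_mul (by linarith)
    (by positivity)).const_mul c).mul_const _) ?_
  filter_upwards [ae_restrict_mem measurableSet_Ioi] with t ht
  have ht' : 0 < t := ht
  rw [norm_mul, norm_mul, Complex.norm_real, Real.norm_of_nonneg (by positivity),
    ← Complex.ofReal_mul, ← Complex.ofReal_neg, ← Complex.ofReal_exp, Complex.norm_real,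
    Real.norm_of_nonneg (by positivity)]
  calc Real.exp (-(v ^ 2 * t)) * (t ^ (a + 1) * ‖f t‖)
      ≤ Real.exp (-(v ^ 2 * t)) * (t ^ (a + 1) * (c * Real.exp (-(2 * κ ^ 2 * (t + t⁻¹))))) := by
        gcongr
        exact hb t ht'
    _ = c * (t ^ (a + 1) * Real.exp (-(v ^ 2 * t) + -(2 * κ ^ 2 * (t + t⁻¹)))) := by
        rw [Real.exp_add]; ring
    _ ≤ c * (t ^ (a + 1) * Real.exp (-(κ ^ 2 * t) + -(2 * κ * |v|))) := by
        refine mul_le_mul_of_nonneg_left (mul_le_mul_of_nonneg_left (Real.exp_le_exp.2 ?_)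
          (by positivity)) hc
        -- AM-GM turns the decay at `t = 0` into decay in `v`; the unused `κ ^ 2 * t` keeps the
        -- integral finite.
        have h1 : 2 * κ * |v| ≤ v ^ 2 * t + κ ^ 2 * t⁻¹ := by
          have h2 : 0 ≤ (|v| * t - κ) ^ 2 * t⁻¹ := by positivity
          have h3 : (|v| * t - κ) ^ 2 * t⁻¹ = v ^ 2 * t + κ ^ 2 * t⁻¹ - 2 * κ * |v| := by
            rw [← sq_abs v]
            field_simp
            ring
          linarith
        nlinarith [mul_pos (pow_pos hκ 2) ht', mul_pos (pow_pos hκ 2) (inv_pos.2 ht')]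
    _ = _ := by rw [Real.exp_add]; ring

theorem integrableOn_mul_zpow_neg (hκ : 0 < κ) (hf : ContinuousOn f (Ioi 0))
    (hb : ∀ t, 0 < t → ‖f t‖ ≤ c * Real.exp (-(κ ^ 2 * (t + t⁻¹)))) (m : ℕ) :
    IntegrableOn (fun t : ℝ => f t * (t : ℂ) ^ (-(m : ℤ))) (Ioi 0) := by
  have hc : 0 ≤ c := nonneg_of_mul_nonneg_left ((norm_nonneg _).trans (hb 1 one_pos))
    (Real.exp_pos _)
  have h1 := (integrableOn_rpow_mul_exp_neg_mul (s := 0) (by norm_num)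
    (show 0 < κ ^ 2 by positivity)).const_mul (c * (m.factorial / (κ ^ 2) ^ m))
  refine h1.mono' ?_ ?_
  · exact (hf.aestronglyMeasurable measurableSet_Ioi).mul
      (by fun_prop : Measurable fun t : ℝ => (t : ℂ) ^ (-(m : ℤ))).aestronglyMeasurable
  filter_upwards [ae_restrict_mem measurableSet_Ioi] with t ht
  have ht' : 0 < t := ht
  have h2 : (t⁻¹) ^ m * Real.exp (-(κ ^ 2 * t⁻¹)) ≤ m.factorial / (κ ^ 2) ^ m := by
    have := Real.pow_div_factorial_le_exp (x := κ ^ 2 * t⁻¹) (by positivity) m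
    rw [Real.exp_neg, ← div_eq_mul_inv, div_le_div_iff₀ (Real.exp_pos _) (by positivity)]
    rw [div_le_iff₀ (by positivity), mul_pow] at this
    linarith
  rw [norm_mul, zpow_neg, zpow_natCast, norm_inv, norm_pow, Complex.norm_real,
    Real.norm_of_nonneg ht'.le, ← inv_pow, Real.rpow_zero, one_mul]
  calc ‖f t‖ * t⁻¹ ^ m ≤ c * Real.exp (-(κ ^ 2 * (t + t⁻¹))) * t⁻¹ ^ m := by
        gcongr
        exact hb t ht'
    _ = c * ((t⁻¹) ^ m * Real.exp (-(κ ^ 2 * t⁻¹))) * Real.exp (-(κ ^ 2 * t)) := by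
        rw [mul_add, neg_add, Real.exp_add]; ring
    _ ≤ _ := by gcongr

theorem moment_laplace_rpowWeight (ha : 0 < a) (hκ : 0 < κ) (hf : ContinuousOn f (Ioi 0))
    (hb : ∀ t, 0 < t → ‖f t‖ ≤ c * Real.exp (-(κ ^ 2 * (t + t⁻¹)))) (m : ℕ) :
    IntegrableOn (fun u : ℝ => ((u ^ (m + a) : ℝ) : ℂ) * laplace (rpowWeight a f) u) (Ioi 0) ∧
    ∫ u in Ioi (0 : ℝ), ((u ^ (m + a) : ℝ) : ℂ) * laplace (rpowWeight a f) u =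
      ((Real.Gamma (m + 1 + a) : ℝ) : ℂ) * ∫ t in Ioi (0 : ℝ), f t * (t : ℂ) ^ (-(m : ℤ)) := by
  set μ : Measure ℝ := volume.restrict (Ioi 0)
  let H : ℝ → ℝ → ℂ := fun t u =>
    ((u ^ (m + a) * Real.exp (-(u * t)) : ℝ) : ℂ) * (((t ^ (a + 1) : ℝ) : ℂ) * f t)
  have hm : (-1 : ℝ) < m + a := by positivity |> (neg_one_lt_zero.trans ·)
  have hG : ∀ t : ℝ, 0 < t → ∫ u in Ioi (0 : ℝ), u ^ (m + a) * Real.exp (-(u * t)) =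
      (1 / t) ^ (m + 1 + a) * Real.Gamma (m + 1 + a) := fun t ht => by
    rw [← Real.integral_rpow_mul_exp_neg_mul_Ioi (by linarith) ht]
    refine setIntegral_congr_fun measurableSet_Ioi fun u _ => ?_
    rw [mul_comm u t]
    congr 2
    ring
  -- The weight exponent `a + 1` is chosen for this: exactly `t ^ (-m)` remains.
  have hpow : ∀ t : ℝ, 0 < t → (1 / t) ^ (m + 1 + a) * t ^ (a + 1) = (t⁻¹) ^ m := fun t ht => by
    rw [one_div, Real.inv_rpow ht.le, ← Real.rpow_neg ht.le, ← Real.rpow_add ht, inv_pow,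
      ← Real.rpow_natCast, ← Real.rpow_neg ht.le]
    congr 1
    ring
  have hmeas : AEStronglyMeasurable (Function.uncurry H) (μ.prod μ) := by
    refine AEStronglyMeasurable.mul ?_ (aestronglyMeasurable_rpow_mul hf).comp_fst
    exact (by fun_prop : Measurable fun p : ℝ × ℝ =>
      ((p.2 ^ (m + a) * Real.exp (-(p.2 * p.1)) : ℝ) : ℂ)).aestronglyMeasurable
  have hint : Integrable (Function.uncurry H) (μ.prod μ) := by
    rw [integrable_prod_iff hmeas]
    constructor
    · filter_upwards [ae_restrict_mem measurableSet_Ioi] with t ht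
      have : IntegrableOn (fun u : ℝ => u ^ (m + a) * Real.exp (-(u * t))) (Ioi 0) := by
        simpa only [mul_comm t] using integrableOn_rpow_mul_exp_neg_mul hm (mem_Ioi.1 ht)
      exact (Integrable.ofReal this).mul_const (((t ^ (a + 1) : ℝ) : ℂ) * f t)
    · have h1 := ((integrableOn_mul_zpow_neg hκ hf hb m).norm).const_mul (Real.Gamma (m + 1 + a))
      refine h1.congr ?_
      filter_upwards [ae_restrict_mem measurableSet_Ioi] with t ht
      have ht' : 0 < t := ht
      have h2 : ∀ u ∈ Ioi (0 : ℝ), ‖Function.uncurry H (t, u)‖ =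
          u ^ (m + a) * Real.exp (-(u * t)) * (t ^ (a + 1) * ‖f t‖) := fun u hu => by
        have hu' : 0 < u := hu
        simp only [Function.uncurry, H]
        rw [norm_mul, norm_mul, Complex.norm_real, Complex.norm_real,
          Real.norm_of_nonneg (by positivity), Real.norm_of_nonneg (by positivity)]
      rw [setIntegral_congr_fun measurableSet_Ioi h2, integral_mul_const, hG t ht', norm_mul,
        zpow_neg, zpow_natCast, norm_inv, norm_pow, Complex.norm_real, Real.norm_of_nonneg ht'.le,
        ← inv_pow, ← hpow t ht']
      ring
  have hinner : ∀ u : ℝ, ∫ t, H t u ∂μ =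
      ((u ^ (m + a) : ℝ) : ℂ) * laplace (rpowWeight a f) u := fun u => by
    rw [laplace_rpowWeight, ← integral_const_mul]
    congr 1 with t
    simp only [H]
    push_cast
    ring
  constructor
  · have := hint.integral_prod_right
    simp only [Function.uncurry, hinner] at this
    exact this
  · simp_rw [← hinner]
    rw [← integral_integral_swap hint, ← integral_const_mul]
    refine setIntegral_congr_fun measurableSet_Ioi fun t ht => ?_
    have ht' : 0 < t := ht
    simp only [H]
    rw [integral_mul_const, integral_complex_ofReal, hG t ht', zpow_neg, zpow_natCast,
      ← inv_pow, ← Complex.ofReal_inv, ← Complex.ofReal_pow, ← hpow t ht']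
    push_cast
    ring

end TwoSidedDecay

/-! ### Determinacy of the half-line moment problem via `u = v ^ 2`. -/

theorem integral_eq_zero_of_even {h : ℝ → ℂ} (hev : ∀ v, h (-v) = h v)
    (h0 : ∫ v in Ioi (0 : ℝ), h v = 0) : ∫ v, h v = 0 := by
  by_cases hi : Integrable h
  · rw [← intervalIntegral.integral_Iic_add_Ioi hi.integrableOn hi.integrableOn (b := 0), h0,
      ← neg_zero (G := ℝ), ← integral_comp_neg_Ioi]
    simp_rw [hev, h0, add_zero]
  -- A non-integrable function has integral 0 by convention.
  · exact integral_undef hi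

theorem integral_eq_zero_of_odd {h : ℝ → ℂ} (hodd : ∀ v, h (-v) = -h v) : ∫ v, h v = 0 := by
  have h1 := integral_neg_eq_self h volume
  simp_rw [hodd, integral_neg] at h1
  exact self_eq_neg.1 h1.symm

section Fintype

variable {ι : Type*} [Fintype ι] {α : ι → ℝ} {L : ι → ℂ → ℂ}

/-- The even function `v ↦ |v| ^ (2 l + 1) * Φ (v ^ 2)`, where `Φ u = ∑ j, u ^ α j * L j u`. -/
noncomputable def evenLift (α : ι → ℝ) (L : ι → ℂ → ℂ) (l : ℕ) (v : ℝ) : ℂ :=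
  ∑ j, ((|v| ^ (2 * l + 1 + 2 * α j) : ℝ) : ℂ) * L j ((v ^ 2 : ℝ) : ℂ)

theorem evenLift_neg (l : ℕ) (v : ℝ) : evenLift α L l (-v) = evenLift α L l v := by
  simp [evenLift]

theorem continuous_evenLift (hα : ∀ j, 0 < α j)
    (hL : ∀ j, Continuous fun v : ℝ => L j ((v ^ 2 : ℝ) : ℂ)) (l : ℕ) :
    Continuous (evenLift α L l) := by
  refine continuous_finsetSum _ fun j _ => Continuous.mul ?_ (hL j)
  refine Complex.continuous_ofReal.comp (continuous_abs.rpow_const fun v => Or.inr ?_)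
  have := hα j
  positivity

theorem integrable_exp_mul_norm_evenLift (hα : ∀ j, 0 < α j)
    (hL : ∀ j, Continuous fun v : ℝ => L j ((v ^ 2 : ℝ) : ℂ)) {κ : ℝ} (hκ : 0 < κ)
    (hb : ∀ j, ∃ C, ∀ v : ℝ, ‖L j ((v ^ 2 : ℝ) : ℂ)‖ ≤ C * Real.exp (-(2 * κ * |v|))) (l : ℕ) :
    Integrable fun v : ℝ => Real.exp (κ * |v|) * ‖evenLift α L l v‖ := by
  choose C hC using hb
  have h1 : Integrable fun v : ℝ =>
      ∑ j, C j * (|v| ^ (2 * l + 1 + 2 * α j) * Real.exp (-(κ * |v|))) :=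
    integrable_finsetSum _ fun j _ => (integrable_abs_rpow_mul_exp_neg_mul_abs
      (by have := hα j; exact neg_one_lt_zero.trans (by positivity)) hκ).const_mul _
  refine h1.mono' (Continuous.aestronglyMeasurable ?_) (Eventually.of_forall fun v => ?_)
  · have := continuous_evenLift hα hL l
    fun_prop
  rw [Real.norm_of_nonneg (by positivity)]
  calc Real.exp (κ * |v|) * ‖evenLift α L l v‖
      ≤ Real.exp (κ * |v|) * ∑ j, |v| ^ (2 * l + 1 + 2 * α j) *
          (C j * Real.exp (-(2 * κ * |v|))) := by
        gcongr
        refine norm_sum_le_of_le _ fun j _ => ?_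
        rw [norm_mul, Complex.norm_real, Real.norm_of_nonneg (by positivity)]
        gcongr
        exact hC j v
    _ = _ := by
        rw [Finset.mul_sum]
        refine Finset.sum_congr rfl fun j _ => ?_
        have : Real.exp (-(κ * |v|)) = Real.exp (κ * |v|) * Real.exp (-(2 * κ * |v|)) := by
          rw [← Real.exp_add]; ring_nf
        rw [this]
        ring

theorem integral_pow_mul_evenLift {l : ℕ}
    (hm : ∀ m : ℕ, l ≤ m →
      ∫ u in Ioi (0 : ℝ), ∑ j, ((u ^ (m + α j) : ℝ) : ℂ) * L j u = 0) (n : ℕ) :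
    ∫ v : ℝ, (v : ℂ) ^ n * evenLift α L l v = 0 := by
  rcases Nat.even_or_odd n with hn | hn
  · refine integral_eq_zero_of_even (fun v => ?_) ?_
    · rw [evenLift_neg, Complex.ofReal_neg, hn.neg_pow]
    obtain ⟨k, rfl⟩ := hn
    have h1 := hm (k + l) (Nat.le_add_left l k)
    rw [← integral_comp_rpow_Ioi_of_pos (two_pos : (0 : ℝ) < 2)] at h1
    have h2 : ∀ v ∈ Ioi (0 : ℝ), (2 * v ^ ((2 : ℝ) - 1)) •
        ∑ j, (((v ^ (2 : ℝ)) ^ (((k + l : ℕ) : ℝ) + α j) : ℝ) : ℂ) * L j ((v ^ (2 : ℝ) : ℝ) : ℂ) =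
        2 * ((v : ℂ) ^ (k + k) * evenLift α L l v) := fun v hv => by
      have hv' : 0 < v := hv
      rw [evenLift, Complex.real_smul, Finset.mul_sum, Finset.mul_sum, Finset.mul_sum]
      refine Finset.sum_congr rfl fun j _ => ?_
      -- The Jacobian's `v` and the shift by `l` account for the exponent `2 * l + 1` in `evenLift`.
      have h3 : v ^ ((2 : ℝ) - 1) * v ^ (2 * (((k + l : ℕ) : ℝ) + α j)) =
          v ^ (k + k) * v ^ (2 * l + 1 + 2 * α j) := by
        rw [← Real.rpow_natCast v (k + k), ← Real.rpow_add hv', ← Real.rpow_add hv']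
        congr 1
        push_cast
        ring
      have h4 := congrArg (fun x : ℝ => (x : ℂ)) h3
      push_cast at h4
      rw [abs_of_pos hv', ← Real.rpow_mul hv'.le, Real.rpow_two]
      push_cast
      linear_combination 2 * L j ((v : ℂ) ^ 2) * h4
    rw [setIntegral_congr_fun measurableSet_Ioi h2, integral_const_mul] at h1
    exact (mul_eq_zero_iff_left two_ne_zero).1 h1
  · refine integral_eq_zero_of_odd fun v => ?_
    rw [evenLift_neg, Complex.ofReal_neg, hn.neg_pow, neg_mul]

theorem sum_rpow_mul_eq_zero_of_moments (hα : ∀ j, 0 < α j)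
    (hL : ∀ j, Continuous fun v : ℝ => L j ((v ^ 2 : ℝ) : ℂ)) {κ : ℝ} (hκ : 0 < κ)
    (hb : ∀ j, ∃ C, ∀ v : ℝ, ‖L j ((v ^ 2 : ℝ) : ℂ)‖ ≤ C * Real.exp (-(2 * κ * |v|))) {l : ℕ}
    (hm : ∀ m : ℕ, l ≤ m → ∫ u in Ioi (0 : ℝ), ∑ j, ((u ^ (m + α j) : ℝ) : ℂ) * L j u = 0)
    {u : ℝ} (hu : 0 < u) : ∑ j, ((u ^ α j : ℝ) : ℂ) * L j u = 0 := by
  have hc := continuous_evenLift hα hL l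
  have h0 : evenLift α L l (√u) = 0 := eq_zero_of_moments_eq_zero hκ hc.aestronglyMeasurable
    (integrable_exp_mul_norm_evenLift hα hL hκ hb l) (integral_pow_mul_evenLift hm) hc.continuousAt
  have hs : 0 < √u := Real.sqrt_pos.2 hu
  have h1 : (((√u) ^ (2 * l + 1 : ℝ) : ℝ) : ℂ) ≠ 0 :=
    Complex.ofReal_ne_zero.2 (Real.rpow_pos_of_pos hs _).ne'
  refine (mul_eq_zero_iff_left h1).1 ?_
  rw [← h0, evenLift, Finset.mul_sum]
  refine Finset.sum_congr rfl fun j _ => ?_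
  rw [abs_of_pos hs, Real.rpow_add hs _ (2 * α j), Real.rpow_mul hs.le 2 (α j), Real.rpow_two,
    Real.sq_sqrt hu.le, Complex.ofReal_mul, mul_assoc]

end Fintype

/-! ### Conclusion. -/

theorem continuous_laplace_rpowWeight_sq {a : ℝ} {f : ℝ → ℂ}
    (hg : Integrable (rpowWeight a f)) :
    Continuous fun v : ℝ => laplace (rpowWeight a f) ((v ^ 2 : ℝ) : ℂ) := by
  refine continuous_of_dominated (bound := fun t => ‖rpowWeight a f t‖)
    (fun v => aestronglyMeasurable_exp_neg_mul hg.1 _)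
    (fun v => Eventually.of_forall fun t => ?_) hg.norm (Eventually.of_forall fun t => by fun_prop)
  by_cases ht : t ∈ Ioi (0 : ℝ)
  · have ht' : 0 < t := ht
    rw [norm_mul]
    refine mul_le_of_le_one_left (norm_nonneg _) ?_
    rw [← Complex.ofReal_mul, ← Complex.ofReal_neg, ← Complex.ofReal_exp, Complex.norm_real,
      Real.norm_of_nonneg (Real.exp_pos _).le]
    exact Real.exp_le_one_iff.2 (neg_nonpos.2 (by positivity))
  · simp [rpowWeight, ht]

theorem proposition3p1 (N : ℕ) (α : Fin N → ℝ) (hα : ∀ j, 0 < α j)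
    (hdiff : ∀ j k : Fin N, j ≠ k → ∀ n : ℤ, α j - α k ≠ (n : ℝ))
    (f : Fin N → ℝ → ℂ) (hf : ∀ j, ContDiffOn ℝ ∞ (f j) (Set.Ioi 0))
    (hbound : ∃ c > (0 : ℝ), ∃ δ > (0 : ℝ), ∀ j,
      (∀ t : ℝ, 1 ≤ t → ‖f j t‖ ≤ c * Real.exp (-δ * t)) ∧
      (∀ t : ℝ, 0 < t → t ≤ 1 → ‖f j t‖ ≤ c * Real.exp (-δ / t)))
    (hsum : ∃ l : ℕ, ∀ m : ℕ, l ≤ m →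
      (∑ j : Fin N, ((Real.Gamma ((m : ℝ) + 1 + α j) : ℝ) : ℂ) *
        (∫ t in Set.Ioi (0 : ℝ), f j t * (t : ℂ) ^ (-(m : ℤ)))) = 0) :
    ∀ j, ∀ t : ℝ, 0 < t → f j t = 0 := by
  obtain ⟨c, hc, δ, hδ, hb⟩ := hbound
  obtain ⟨l, hl⟩ := hsum
  have hcont : ∀ j, ContinuousOn (f j) (Ioi 0) := fun j => (hf j).continuousOn
  -- The factor 2 leaves one `κ ^ 2` for AM-GM and one for integrability in
  -- `norm_laplace_rpowWeight_le`.
  obtain ⟨κ, hκ, hκδ⟩ : ∃ κ : ℝ, 0 < κ ∧ δ / 2 = 2 * κ ^ 2 :=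
    ⟨√(δ / 4), Real.sqrt_pos.2 (by positivity), by rw [Real.sq_sqrt (by positivity)]; ring⟩
  have hdecay : ∀ j t, 0 < t → ‖f j t‖ ≤ c * Real.exp (-(2 * κ ^ 2 * (t + t⁻¹))) :=
    fun j t ht => hκδ ▸ norm_le_of_two_sided_decay hc hδ (hb j).1 (hb j).2 ht
  have hdecay' : ∀ j t, 0 < t → ‖f j t‖ ≤ c * Real.exp (-(κ ^ 2 * (t + t⁻¹))) := by
    intro j t ht
    refine (hdecay j t ht).trans ?_
    have : 0 ≤ κ ^ 2 * (t + t⁻¹) := by positivity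
    gcongr
    linarith
  have hε : 0 < κ ^ 2 / 2 := by positivity
  let g : Fin N → ℝ → ℂ := fun j => rpowWeight (α j) (f j)
  have hg : ∀ j, AEStronglyMeasurable (g j) volume := fun j =>
    aestronglyMeasurable_rpowWeight (hcont j)
  have hint : ∀ j, Integrable fun t : ℝ => Real.exp (κ ^ 2 / 2 * |t|) * ‖g j t‖ := fun j =>
    integrable_exp_mul_norm_rpowWeight (hα j) hκ (hcont j) (hdecay' j)
  have hmom := fun j m => moment_laplace_rpowWeight (hα j) hκ (hcont j) (hdecay' j) m
  have hrel : ∀ u : ℝ, 0 < u → ∑ j, ((u ^ α j : ℝ) : ℂ) * laplace (g j) u = 0 := by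
    intro u hu
    refine sum_rpow_mul_eq_zero_of_moments (L := fun j => laplace (g j)) (l := l) hα
      (fun j => continuous_laplace_rpowWeight_sq (integrable_of_exp_mul hε (hg j) (hint j))) hκ
      (fun j => norm_laplace_rpowWeight_le (hα j) hκ (hdecay j)) (fun m hm => ?_) hu
    rw [integral_finsetSum _ fun j _ => (hmom j m).1, ← hl m hm]
    exact Finset.sum_congr rfl fun j _ => (hmom j m).2
  intro j t ht
  have hana : ∀ j, AnalyticAt ℂ (laplace (g j)) 0 := fun j =>
    (differentiableOn_laplace (hg j) (hint j)).analyticAt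
      ((isOpen_verticalStrip _).mem_nhds (by simpa [verticalStrip] using pow_pos hκ 2))
  have hev := eventually_eq_zero_of_sum_rpow_mul_eq_zero hdiff hana hrel j
  have hzero := eq_zero_of_frequently_laplace_eq_zero hε (hg j) (hint j)
    (hev.filter_mono nhdsWithin_le_nhds).frequently (continuousAt_rpowWeight (hcont j) ht)
  simp only [g, rpowWeight, indicator_of_mem (mem_Ioi.2 ht)] at hzero
  exact (mul_eq_zero_iff_left
    (Complex.ofReal_ne_zero.2 (Real.rpow_pos_of_pos ht _).ne')).1 hzero
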